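/- Fix $H\in(0,1)$ and $m\ge 1$ real numbers $T_1,\dots,T_m>0$, and set $T=T_1+\dots+T_m$. Let $\bar{\mathcal H}([0,T])$ be the Cameron–Martin space of $d$-dimensional fractional Brownian motion with Hurst parameter $H$ over $[0,T]$, that is, the reproducing kernel Hilbert space of functions $[0,T]\to\mathbb R^d$ with kernel $R(s,t)\,\mathrm{Id}_{\mathbb R^d}$, where $R(s,t)=\tfrac12\left(s^{2H}+t^{2H}-|t-s|^{2H}\right)$. For a smooth path $f:[0,S]\to\mathbb R^d$ put $C^2(f)=\|f\|_{\infty;[0,S]}+\|f'\|_{\infty;[0,S]}+\|f''\|_{\infty;[0,S]}$. For each $1\le k\le m$ let $h_k:[0,T_k]\to\mathbb R^d$ be a smooth path (that is, $C^\infty$ up to the end points), with $h_1(0)=0$. Let $h=h_1\sqcup\dots\sqcup h_m:[0,T]\to\mathbb R^d$ be their concatenation, that is, the path with $h(t)=h_1(t)$ for $t\in[0,T_1]$ and, for $2\le k\le m$ and $S_{k-1}=T_1+\dots+T_{k-1}$, $h(t)=h(S_{k-1})+h_k(t-S_{k-1})-h_k(0)$ for $t\in[S_{k-1},S_{k-1}+T_k]$.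 Then: (i) $h\in\bar{\mathcal H}([0,T])$; (ii) the Cameron–Martin norm $\|h\|_{\bar{\mathcal H}([0,T])}$ is bounded by a constant depending only on $H$ and on $T_k$, $C^2(h_k)$, $k=1,\dots,m$. More precisely, for all $M_1,\dots,M_m$ there is a constant $C$ depending only on $H$, $m$, $(T_k)$, $(M_k)$ (and not on $d$) such that $\|h\|_{\bar{\mathcal H}([0,T])}\le C$ for all $d$ and all such $h_1,\dots,h_m$ with $C^2(h_k)\le M_k$ for every $k$. -/

import Mathlib

open scoped ContDiff

/-! ### Fractional Brownian motion: covariance and its positivity -/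

/-- Covariance function of (one-dimensional) fractional Brownian motion with Hurst parameter `H`,
for times `s, t ≥ 0`. -/
noncomputable def fbmCov (H s t : ℝ) : ℝ :=
  (s ^ (2 * H) + t ^ (2 * H) - |t - s| ^ (2 * H)) / 2

theorem fbm_aux_integrable {H : ℝ} (h0 : 0 < H) (h1 : H < 1) (x : ℝ) :
    MeasureTheory.IntegrableOn (fun u : ℝ => (1 - Real.cos (x * u)) * u ^ (-1 - 2 * H))
      (Set.Ioi 0) := by
  have hmeas : ∀ s : Set ℝ, MeasureTheory.AEStronglyMeasurable
      (fun u : ℝ => (1 - Real.cos (x * u)) * u ^ (-1 - 2 * H))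
      (MeasureTheory.volume.restrict s) := by
    intro s
    apply Measurable.aestronglyMeasurable
    fun_prop
  rw [← Set.Ioc_union_Ioi_eq_Ioi (zero_le_one (α := ℝ))]
  apply MeasureTheory.IntegrableOn.union
  · have hi : MeasureTheory.IntegrableOn (fun u : ℝ => x ^ 2 / 2 * u ^ (1 - 2 * H))
        (Set.Ioc 0 1) := by
      have := intervalIntegral.intervalIntegrable_rpow' (a := 0) (b := 1) (r := 1 - 2 * H)
        (by linarith)
      rw [intervalIntegrable_iff_integrableOn_Ioc_of_le zero_le_one] at this
      exact this.const_mul _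
    refine MeasureTheory.Integrable.mono' hi (hmeas _) ?_
    refine (MeasureTheory.ae_restrict_iff' measurableSet_Ioc).2 (Filter.Eventually.of_forall ?_)
    intro u hu
    have hc1 := Real.cos_le_one (x * u)
    have hc2 := Real.one_sub_sq_div_two_le_cos (x := x * u)
    have hp : 0 ≤ u ^ (-1 - 2 * H) := Real.rpow_nonneg hu.1.le _
    have he : u ^ (1 - 2 * H) = u ^ 2 * u ^ (-1 - 2 * H) := by
      rw [← Real.rpow_natCast u 2, ← Real.rpow_add hu.1]
      norm_num
      ring_nf
    rw [Real.norm_of_nonneg (mul_nonneg (by linarith) hp), he, ← mul_assoc]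
    exact mul_le_mul_of_nonneg_right (by nlinarith) hp
  · have hi : MeasureTheory.IntegrableOn (fun u : ℝ => 2 * u ^ (-1 - 2 * H)) (Set.Ioi 1) :=
      (integrableOn_Ioi_rpow_of_lt (by linarith) one_pos).const_mul _
    refine MeasureTheory.Integrable.mono' hi (hmeas _) ?_
    refine (MeasureTheory.ae_restrict_iff' measurableSet_Ioi).2 (Filter.Eventually.of_forall ?_)
    intro u hu
    have hu0 : (0 : ℝ) < u := lt_trans one_pos hu
    have hc1 := Real.cos_le_one (x * u)
    have hc2 := Real.neg_one_le_cos (x * u)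
    have hp : 0 ≤ u ^ (-1 - 2 * H) := Real.rpow_nonneg hu0.le _
    rw [Real.norm_of_nonneg (mul_nonneg (by linarith) hp)]
    exact mul_le_mul_of_nonneg_right (by linarith) hp

theorem fbm_aux_scaling {H : ℝ} (h0 : 0 < H) (x : ℝ) :
    ∫ u in Set.Ioi (0 : ℝ), (1 - Real.cos (x * u)) * u ^ (-1 - 2 * H)
      = |x| ^ (2 * H) * ∫ u in Set.Ioi (0 : ℝ), (1 - Real.cos u) * u ^ (-1 - 2 * H) := by
  rcases eq_or_ne x 0 with rfl | hx
  · simp [Real.zero_rpow (by linarith : 2 * H ≠ 0)]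
  have hx' : 0 < |x| := abs_pos.2 hx
  have key := MeasureTheory.integral_comp_mul_left_Ioi
    (fun u : ℝ => (1 - Real.cos u) * u ^ (-1 - 2 * H)) 0 hx'
  rw [mul_zero] at key
  have e : ∫ u in Set.Ioi (0 : ℝ), (1 - Real.cos (|x| * u)) * (|x| * u) ^ (-1 - 2 * H)
      = |x| ^ (-1 - 2 * H) *
        ∫ u in Set.Ioi (0 : ℝ), (1 - Real.cos (x * u)) * u ^ (-1 - 2 * H) := by
    rw [← MeasureTheory.integral_const_mul]
    refine MeasureTheory.setIntegral_congr_fun measurableSet_Ioi ?_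
    intro u hu
    have hu0 : (0 : ℝ) < u := hu
    have hc : Real.cos (|x| * u) = Real.cos (x * u) := by
      rw [← Real.cos_abs (x * u), abs_mul, abs_of_pos hu0]
    simp only [hc]
    rw [Real.mul_rpow hx'.le hu0.le]
    ring
  rw [e, smul_eq_mul] at key
  have hm : |x| ^ (2 * H) * |x| * |x| ^ (-1 - 2 * H) = 1 := by
    rw [← Real.rpow_add_one hx'.ne', ← Real.rpow_add hx',
      show 2 * H + 1 + (-1 - 2 * H) = 0 by ring, Real.rpow_zero]
  calc _ = (|x| ^ (2 * H) * |x| * |x| ^ (-1 - 2 * H)) *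
        ∫ u in Set.Ioi (0 : ℝ), (1 - Real.cos (x * u)) * u ^ (-1 - 2 * H) := by rw [hm, one_mul]
    _ = |x| ^ (2 * H) * |x| * (|x| ^ (-1 - 2 * H) *
        ∫ u in Set.Ioi (0 : ℝ), (1 - Real.cos (x * u)) * u ^ (-1 - 2 * H)) := by ring
    _ = _ := by rw [key]; field_simp

theorem fbm_aux_pos {H : ℝ} (h0 : 0 < H) (h1 : H < 1) :
    0 < ∫ u in Set.Ioi (0 : ℝ), (1 - Real.cos u) * u ^ (-1 - 2 * H) := by
  have hint := fbm_aux_integrable h0 h1 1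
  simp only [one_mul] at hint
  have hnn : ∀ u ∈ Set.Ioi (0 : ℝ), 0 ≤ (1 - Real.cos u) * u ^ (-1 - 2 * H) := fun u hu =>
    mul_nonneg (by linarith [Real.cos_le_one u]) (Real.rpow_nonneg (le_of_lt hu) _)
  refine (MeasureTheory.setIntegral_pos_iff_support_of_nonneg_ae
    ((MeasureTheory.ae_restrict_iff' measurableSet_Ioi).2 (Filter.Eventually.of_forall hnn))
    hint).2 ?_
  refine lt_of_lt_of_le ?_ (MeasureTheory.measure_mono (s := Set.Ioo (0 : ℝ) 1) ?_)
  · simp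
  · intro u hu
    refine ⟨?_, hu.1⟩
    have hc : Real.cos u < 1 := by
      have := Real.cos_lt_cos_of_nonneg_of_le_pi_div_two le_rfl
        (by linarith [Real.pi_gt_three, hu.2] : u ≤ Real.pi / 2) hu.1
      simpa using this
    exact (mul_pos (by linarith) (Real.rpow_pos_of_pos hu.1 _)).ne'

theorem fbmCov_psd {H : ℝ} (h0 : 0 < H) (h1 : H < 1) {V : Type*} [NormedAddCommGroup V]
    [InnerProductSpace ℝ V] {ι : Type*} (S : Finset ι) (t : ι → ℝ) (ht : ∀ i, 0 ≤ t i)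
    (w : ι → V) : 0 ≤ ∑ i ∈ S, ∑ j ∈ S, fbmCov H (t j) (t i) * inner ℝ (w i) (w j) := by
  set c := ∫ u in Set.Ioi (0 : ℝ), (1 - Real.cos u) * u ^ (-1 - 2 * H) with hc
  have hcpos : 0 < c := fbm_aux_pos h0 h1
  let F : ℝ → ℝ → ℝ := fun x u => (1 - Real.cos (x * u)) * u ^ (-1 - 2 * H)
  have hF : ∀ x, MeasureTheory.IntegrableOn (F x) (Set.Ioi 0) := fbm_aux_integrable h0 h1
  have hI : ∀ x, ∫ u in Set.Ioi (0 : ℝ), F x u = |x| ^ (2 * H) * c := fbm_aux_scaling h0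
  have hint : ∀ i j, MeasureTheory.IntegrableOn
      (fun u => (F (t j) u + F (t i) u - F (t i - t j) u) / 2 * inner ℝ (w i) (w j))
      (Set.Ioi 0) := fun i j =>
    ((((hF (t j)).add (hF (t i))).sub (hF (t i - t j))).div_const 2).mul_const _
  have hterm : ∀ i j, c * (fbmCov H (t j) (t i) * inner ℝ (w i) (w j)) =
      ∫ u in Set.Ioi (0 : ℝ),
        (F (t j) u + F (t i) u - F (t i - t j) u) / 2 * inner ℝ (w i) (w j) := by
    intro i j
    have e1 : ∫ u in Set.Ioi (0 : ℝ), (F (t j) u + F (t i) u - F (t i - t j) u) =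
        (∫ u in Set.Ioi (0 : ℝ), (F (t j) u + F (t i) u)) -
          ∫ u in Set.Ioi (0 : ℝ), F (t i - t j) u :=
      MeasureTheory.integral_sub ((hF (t j)).add (hF (t i))) (hF (t i - t j))
    rw [MeasureTheory.integral_mul_const, MeasureTheory.integral_div, e1,
      MeasureTheory.integral_add (hF (t j)) (hF (t i)), hI, hI, hI,
      abs_of_nonneg (ht i), abs_of_nonneg (ht j), fbmCov]
    ring
  refine nonneg_of_mul_nonneg_right (a := c) ?_ hcpos
  have hsum : c * ∑ i ∈ S, ∑ j ∈ S, fbmCov H (t j) (t i) * inner ℝ (w i) (w j) =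
      ∫ u in Set.Ioi (0 : ℝ), ∑ i ∈ S, ∑ j ∈ S,
        (F (t j) u + F (t i) u - F (t i - t j) u) / 2 * inner ℝ (w i) (w j) := by
    rw [MeasureTheory.integral_finsetSum _
      (fun i _ => MeasureTheory.integrable_finsetSum _ (fun j _ => hint i j)), Finset.mul_sum]
    refine Finset.sum_congr rfl fun i _ => ?_
    rw [MeasureTheory.integral_finsetSum _ (fun j _ => hint i j), Finset.mul_sum]
    exact Finset.sum_congr rfl fun j _ => hterm i j
  rw [hsum]
  refine MeasureTheory.setIntegral_nonneg measurableSet_Ioi fun u hu => ?_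
  have hu0 : (0 : ℝ) < u := hu
  have hid : ∑ i ∈ S, ∑ j ∈ S,
        (F (t j) u + F (t i) u - F (t i - t j) u) / 2 * inner ℝ (w i) (w j)
      = u ^ (-1 - 2 * H) / 2 *
        (inner ℝ (∑ i ∈ S, (1 - Real.cos (t i * u)) • w i)
            (∑ i ∈ S, (1 - Real.cos (t i * u)) • w i)
          + inner ℝ (∑ i ∈ S, Real.sin (t i * u) • w i)
            (∑ i ∈ S, Real.sin (t i * u) • w i)) := by
    simp only [sum_inner, inner_sum, inner_smul_left, inner_smul_right, RCLike.conj_to_real]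
    rw [← Finset.sum_add_distrib, Finset.mul_sum]
    refine Finset.sum_congr rfl fun i _ => ?_
    rw [Finset.mul_sum, Finset.mul_sum, ← Finset.sum_add_distrib, Finset.mul_sum]
    refine Finset.sum_congr rfl fun j _ => ?_
    simp only [F, sub_mul (t i), Real.cos_sub]
    rw [real_inner_comm]
    ring
  rw [hid]
  have hp : 0 ≤ u ^ (-1 - 2 * H) := Real.rpow_nonneg hu0.le _
  have e1 := real_inner_self_nonneg (x := ∑ i ∈ S, (1 - Real.cos (t i * u)) • w i)
  have e2 := real_inner_self_nonneg (x := ∑ i ∈ S, Real.sin (t i * u) • w i)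
  positivity

/-- Matrix-valued covariance kernel `(s, t) ↦ R(s, t) Id` on `[0, T]` of `d`-dimensional fractional
Brownian motion (independent components, each with covariance `fbmCov H`). -/
noncomputable def fbmKernel (H T : ℝ) (d : ℕ) :
    Matrix (Set.Icc (0 : ℝ) T) (Set.Icc (0 : ℝ) T)
      (EuclideanSpace ℝ (Fin d) →L[ℝ] EuclideanSpace ℝ (Fin d)) :=
  Matrix.of fun s t => fbmCov H s t • ContinuousLinearMap.id ℝ (EuclideanSpace ℝ (Fin d))

theorem fbmCov_comm (H s t : ℝ) : fbmCov H s t = fbmCov H t s := by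
  unfold fbmCov
  rw [abs_sub_comm]
  ring

instance fbmKernel_posSemidef (H : Set.Ioo (0 : ℝ) 1) (T : ℝ) (d : ℕ) :
    Fact (fbmKernel H T d).PosSemidef := by
  have hiff := (RKHS.posSemidef_tfae (K := fbmKernel H T d)).out 0 2
  refine ⟨hiff.2 ⟨?_, ?_⟩⟩
  · refine Matrix.ext fun s t => ?_
    simp only [Matrix.conjTranspose_apply, fbmKernel, Matrix.of_apply, star_smul, star_trivial]
    rw [fbmCov_comm]
    exact congrArg (fbmCov H s t • ·)
      (star_one (EuclideanSpace ℝ (Fin d) →L[ℝ] EuclideanSpace ℝ (Fin d)))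
  · intro v
    have h := fbmCov_psd H.2.1 H.2.2 v.support (fun i : Set.Icc (0 : ℝ) T => (i : ℝ))
      (fun i => i.2.1) v
    simpa [Finsupp.sum, fbmKernel, inner_smul_left] using h

/-- The Cameron-Martin space of `d`-dimensional fractional Brownian motion with Hurst parameter
`H ∈ (0, 1)` over `[0, T]`: the reproducing kernel Hilbert space, made of functions
`[0, T] → ℝ^d`, of its covariance. An element `g` is coerced to the function `⇑g`. -/
abbrev FBmCameronMartin (H : Set.Ioo (0 : ℝ) 1) (T : ℝ) (d : ℕ) : Type :=
  RKHS.OfKernel (fbmKernel H T d)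

/-! ### Paths -/

/-- Supremum norm over `[0, T]` of a path (finite for the continuous functions it is used for). -/
noncomputable def supNormOn {V : Type*} [NormedAddCommGroup V] (T : ℝ) (f : ℝ → V) : ℝ :=
  ⨆ t : Set.Icc (0 : ℝ) T, ‖f t‖

/-- The `C²` norm over `[0, T]`, with one-sided derivatives at the end points. -/
noncomputable def C2Norm {V : Type*} [NormedAddCommGroup V] [NormedSpace ℝ V]
    (T : ℝ) (f : ℝ → V) : ℝ :=
  supNormOn T f + supNormOn T (derivWithin f (Set.Icc 0 T))
    + supNormOn T (iteratedDerivWithin 2 f (Set.Icc 0 T))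

/-- Concatenation of a path `f` over `[0, S]` with a path `g` started at time `0`: after time `S`
one follows the increments of `g`. -/
noncomputable def concatTwo {V : Type*} [AddCommGroup V] (S : ℝ) (f g : ℝ → V) (t : ℝ) : V :=
  if t ≤ S then f t else f S + (g (t - S) - g 0)

/-- Concatenation `h 0 ⊔ ⋯ ⊔ h n` of `n + 1` paths, `h k` being a path over `[0, T k]`; the result
is a path over `[0, ∑ k, T k]`. -/
noncomputable def concatPaths {V : Type*} [AddCommGroup V] :
    (n : ℕ) → (Fin (n + 1) → ℝ) → (Fin (n + 1) → ℝ → V) → ℝ → V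
  | 0, _, h => h 0
  | n + 1, T, h =>
    concatTwo (∑ k : Fin (n + 1), T k.castSucc)
      (concatPaths n (fun k => T k.castSucc) (fun k => h k.castSucc)) (h (Fin.last (n + 1)))

/-! A function lies in an RKHS with norm at most `C` as soon as its pairing with every finite
combination of point evaluations is at most `C` times the norm of the corresponding combination of
kernel functions. So it suffices to test the concatenated path against finitely supported weights
`w`. By Taylor's formula each piece, frozen outside its time interval, is a superposition of ramps
`t ↦ max (t - s) 0` with coefficients given by its first two derivatives
(`sub_apply_zero_eq_ramp_integral`). Everything reduces to one bound on ramps, uniform in the kink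
`s ≥ 0` (`norm_sum_ramp_smul_le`). That bound is Cauchy–Schwarz on the spectral side. The fBm norm
of the weights has spectral density `u ^ (-1 - 2H)`, the ramp pairing has `u ^ (-2)`, and the latter
is the geometric mean of the densities for `H` and `1 - H`. Since `1 - H ∈ (0, 1)`, the remaining
factor is integrable. Vector-valued weights are treated at once, so no constant depends on `d`. -/

/-! ### Membership in an RKHS by duality. -/

/-- The bound lets the pairing with `f` descend to a functional of norm at most `C` on the span of
the kernel functions. That span is dense, so the functional extends, and its Riesz representative
takes the values of `f` by the reproducing property. -/
theorem RKHS.exists_norm_le_of_abs_sum_inner_le {X V E : Type*} [NormedAddCommGroup V]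
    [InnerProductSpace ℝ V] [CompleteSpace V] [NormedAddCommGroup E] [InnerProductSpace ℝ E]
    [CompleteSpace E] [RKHS ℝ E X V] {f : X → V} {C : ℝ} (hC : 0 ≤ C)
    (hf : ∀ w : X →₀ V, |w.sum fun x v => inner ℝ (f x) v|
      ≤ C * ‖w.sum fun x v => RKHS.kerFun E x v‖) :
    ∃ g : E, (∀ x, g x = f x) ∧ ‖g‖ ≤ C := by
  let e : (X →₀ V) →ₗ[ℝ] E := Finsupp.lsum ℝ fun x => (RKHS.kerFun E x : V →ₗ[ℝ] E)
  let φ : (X →₀ V) →ₗ[ℝ] ℝ := Finsupp.lsum ℝ fun x => (innerSL ℝ (f x) : V →ₗ[ℝ] ℝ)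
  have hdense : DenseRange e := by
    have h1 : Submodule.span ℝ {RKHS.kerFun E x v | (x : X) (v : V)} ≤ LinearMap.range e := by
      rw [Submodule.span_le]
      rintro _ ⟨x, v, rfl⟩
      exact ⟨Finsupp.single x v, by simp [e]⟩
    have h2 := Submodule.topologicalClosure_mono h1
    rw [RKHS.kerFun_dense, top_le_iff] at h2
    rw [DenseRange, ← LinearMap.coe_range]
    exact Submodule.dense_iff_topologicalClosure_eq_top.2 h2
  have hb : ∀ w, ‖φ w‖ ≤ C * ‖e w‖ := fun w => by
    simpa [φ, e, Finsupp.sum, Real.norm_eq_abs] using hf w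
  let g : E := (InnerProductSpace.toDual ℝ E).symm (φ.extendOfNorm e)
  refine ⟨g, fun x => ext_inner_right ℝ fun v => ?_, ?_⟩
  · rw [← RKHS.inner_kerFun, InnerProductSpace.toDual_symm_apply]
    have := LinearMap.extendOfNorm_eq hdense ⟨C, hb⟩ (Finsupp.single x v)
    simpa [e, φ] using this
  · rw [LinearIsometryEquiv.norm_map]
    exact LinearMap.opNorm_extendOfNorm_le hdense hC hb

/-! ### Uniform spectral estimate for ramps. -/

/-- The exponent is that of the scaling identity at Hurst parameter `1 / 2`. The terms shifted by
`L` add no kink inside `[0, L]`, but they make the ramp's spectral factor vanish at `u = 0`, without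
which the integral for `1 - H` would diverge. -/
theorem fbm_aux_integral_cross {s L t : ℝ} (hs : 0 ≤ s) (ht : 0 ≤ t) (htL : t ≤ L) :
    |t - s| ^ (2 * (1 / 2) : ℝ) - |s| ^ (2 * (1 / 2) : ℝ) - |t - s - L| ^ (2 * (1 / 2) : ℝ)
      + |s + L| ^ (2 * (1 / 2) : ℝ) = 2 * max (t - s) 0 := by
  norm_num
  rw [abs_of_nonneg hs, abs_of_nonneg (by linarith : 0 ≤ s + L),
    abs_of_nonpos (by linarith : t - s - L ≤ 0)]
  rcases le_total t s with h | h
  · rw [max_eq_right (by linarith), abs_of_nonpos (by linarith)]; ring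
  · rw [max_eq_left (by linarith), abs_of_nonneg (by linarith)]; ring

/-- The integral `∫₀^∞ (1 - cos u) u^(-1-2H) du`, which normalizes the spectral representation of
the fractional Brownian covariance. -/
noncomputable def fbmSpectralConst (H : ℝ) : ℝ :=
  ∫ u in Set.Ioi (0 : ℝ), (1 - Real.cos u) * u ^ (-1 - 2 * H)

/-- Cauchy–Schwarz in polynomial form: the quadratic in `r` is the integral over frequencies of a
nonnegative weight times a sum of two squared norms. -/
theorem fbm_ramp_quadratic_nonneg {H : ℝ} (h0 : 0 < H) (h1 : H < 1) {V : Type*}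
    [NormedAddCommGroup V] [InnerProductSpace ℝ V] {ι : Type*} (S : Finset ι) (t : ι → ℝ) {L : ℝ}
    (ht : ∀ i, t i ∈ Set.Icc 0 L) (w : ι → V) {s : ℝ} (hs : 0 ≤ s) (v : V) (r : ℝ) :
    0 ≤ (fbmSpectralConst (1 - H) * |L| ^ (2 * (1 - H)) * ‖v‖ ^ 2) * (r * r)
      + (-(2 * fbmSpectralConst (1 / 2)) * inner ℝ (∑ i ∈ S, max (t i - s) 0 • w i) v) * r
      + fbmSpectralConst H * ∑ i ∈ S, ∑ j ∈ S, fbmCov H (t j) (t i) * inner ℝ (w i) (w j) := by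
  let F : ℝ → ℝ → ℝ → ℝ := fun H x u => (1 - Real.cos (x * u)) * u ^ (-1 - 2 * H)
  have hF : ∀ x, MeasureTheory.IntegrableOn (F H x) (Set.Ioi 0) := fbm_aux_integrable h0 h1
  have hF' : ∀ x, MeasureTheory.IntegrableOn (F (1 / 2) x) (Set.Ioi 0) :=
    fbm_aux_integrable (by norm_num) (by norm_num)
  have hF'' : ∀ x, MeasureTheory.IntegrableOn (F (1 - H) x) (Set.Ioi 0) :=
    fbm_aux_integrable (by linarith) (by linarith)
  have hI : ∀ x, ∫ u in Set.Ioi (0 : ℝ), F H x u = |x| ^ (2 * H) * fbmSpectralConst H :=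
    fbm_aux_scaling h0
  have hI' : ∀ x, ∫ u in Set.Ioi (0 : ℝ), F (1 / 2) x u
      = |x| ^ (2 * (1 / 2) : ℝ) * fbmSpectralConst (1 / 2) :=
    fbm_aux_scaling (by norm_num)
  have hI'' : ∀ x, ∫ u in Set.Ioi (0 : ℝ), F (1 - H) x u
      = |x| ^ (2 * (1 - H)) * fbmSpectralConst (1 - H) :=
    fbm_aux_scaling (by linarith)
  let P : ℝ → ℝ := fun u => ∑ i ∈ S, ∑ j ∈ S,
    (F H (t j) u + F H (t i) u - F H (t i - t j) u) / 2 * inner ℝ (w i) (w j)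
  let R : ℝ → ℝ := fun u => ∑ i ∈ S,
    (F (1 / 2) (t i - s) u - F (1 / 2) s u - F (1 / 2) (t i - s - L) u + F (1 / 2) (s + L) u)
      * inner ℝ (w i) v
  have hPi : ∀ i j, MeasureTheory.IntegrableOn
      (fun u => (F H (t j) u + F H (t i) u - F H (t i - t j) u) / 2 * inner ℝ (w i) (w j))
      (Set.Ioi 0) := fun i j =>
    ((((hF (t j)).add (hF (t i))).sub (hF (t i - t j))).div_const 2).mul_const _
  have hPint : MeasureTheory.IntegrableOn P (Set.Ioi 0) :=
    MeasureTheory.integrable_finsetSum _ fun i _ =>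
      MeasureTheory.integrable_finsetSum _ fun j _ => hPi i j
  have hRi : ∀ i, MeasureTheory.IntegrableOn
      (fun u => (F (1 / 2) (t i - s) u - F (1 / 2) s u - F (1 / 2) (t i - s - L) u
        + F (1 / 2) (s + L) u) * inner ℝ (w i) v) (Set.Ioi 0) := fun i =>
    ((((hF' (t i - s)).sub (hF' s)).sub (hF' (t i - s - L))).add (hF' (s + L))).mul_const _
  have hRint : MeasureTheory.IntegrableOn R (Set.Ioi 0) :=
    MeasureTheory.integrable_finsetSum _ fun i _ => hRi i
  have hP : ∫ u in Set.Ioi (0 : ℝ), P u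
      = fbmSpectralConst H * ∑ i ∈ S, ∑ j ∈ S, fbmCov H (t j) (t i) * inner ℝ (w i) (w j) := by
    rw [MeasureTheory.integral_finsetSum _
      (fun i _ => MeasureTheory.integrable_finsetSum _ (fun j _ => hPi i j)), Finset.mul_sum]
    refine Finset.sum_congr rfl fun i _ => ?_
    rw [MeasureTheory.integral_finsetSum _ (fun j _ => hPi i j), Finset.mul_sum]
    refine Finset.sum_congr rfl fun j _ => ?_
    have e1 : ∫ u in Set.Ioi (0 : ℝ), (F H (t j) u + F H (t i) u - F H (t i - t j) u) =
        (∫ u in Set.Ioi (0 : ℝ), (F H (t j) u + F H (t i) u)) -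
          ∫ u in Set.Ioi (0 : ℝ), F H (t i - t j) u :=
      MeasureTheory.integral_sub ((hF (t j)).add (hF (t i))) (hF (t i - t j))
    rw [MeasureTheory.integral_mul_const, MeasureTheory.integral_div, e1,
      MeasureTheory.integral_add (hF (t j)) (hF (t i)), hI, hI, hI,
      abs_of_nonneg (ht i).1, abs_of_nonneg (ht j).1, fbmCov]
    ring
  have hR : ∫ u in Set.Ioi (0 : ℝ), R u
      = 2 * fbmSpectralConst (1 / 2) * inner ℝ (∑ i ∈ S, max (t i - s) 0 • w i) v := by
    rw [MeasureTheory.integral_finsetSum _ (fun i _ => hRi i), sum_inner, Finset.mul_sum]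
    refine Finset.sum_congr rfl fun i _ => ?_
    have e1 : ∫ u in Set.Ioi (0 : ℝ), (F (1 / 2) (t i - s) u - F (1 / 2) s u
          - F (1 / 2) (t i - s - L) u + F (1 / 2) (s + L) u) =
        (∫ u in Set.Ioi (0 : ℝ), F (1 / 2) (t i - s) u) - (∫ u in Set.Ioi (0 : ℝ), F (1 / 2) s u)
          - (∫ u in Set.Ioi (0 : ℝ), F (1 / 2) (t i - s - L) u)
          + ∫ u in Set.Ioi (0 : ℝ), F (1 / 2) (s + L) u := by
      have i2 : MeasureTheory.IntegrableOn
          (fun u => F (1 / 2) (t i - s) u - F (1 / 2) s u) (Set.Ioi 0) := (hF' _).sub (hF' _)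
      have i3 : MeasureTheory.IntegrableOn (fun u => F (1 / 2) (t i - s) u - F (1 / 2) s u
          - F (1 / 2) (t i - s - L) u) (Set.Ioi 0) := i2.sub (hF' _)
      rw [MeasureTheory.integral_add i3 (hF' _), MeasureTheory.integral_sub i2 (hF' _),
        MeasureTheory.integral_sub (hF' _) (hF' _)]
    rw [MeasureTheory.integral_mul_const, e1, hI', hI', hI', hI', ← sub_mul, ← sub_mul, ← add_mul,
      fbm_aux_integral_cross hs (ht i).1 (ht i).2, inner_smul_left, RCLike.conj_to_real]
    ring
  have hpos : 0 ≤ ∫ u in Set.Ioi (0 : ℝ), (P u - r * R u + r * r * ‖v‖ ^ 2 * F (1 - H) L u) := by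
    refine MeasureTheory.setIntegral_nonneg measurableSet_Ioi fun u hu => ?_
    have hu0 : (0 : ℝ) < u := hu
    set p := u ^ (-1 - 2 * H) with hp
    set q := u ^ (2 * H - 1) with hq
    have hpq : u ^ (-1 - 2 * (1 / 2) : ℝ) = p * q := by
      rw [hp, hq, ← Real.rpow_add hu0]; ring_nf
    have hpqq : u ^ (-1 - 2 * (1 - H)) = p * q * q := by
      rw [hp, hq, ← Real.rpow_add hu0, ← Real.rpow_add hu0]; ring_nf
    have hp0 : 0 ≤ p := Real.rpow_nonneg hu0.le _
    set a := Real.cos (s * u) - Real.cos (s * u + L * u) with ha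
    set b := Real.sin (s * u) - Real.sin (s * u + L * u) with hb
    set X := ∑ i ∈ S, (1 - Real.cos (t i * u)) • w i with hX
    set Y := ∑ i ∈ S, Real.sin (t i * u) • w i with hY
    have hPu : P u = p / 2 * (inner ℝ X X + inner ℝ Y Y) := by
      simp only [P, hX, hY, sum_inner, inner_sum, inner_smul_left, inner_smul_right,
        RCLike.conj_to_real]
      rw [← Finset.sum_add_distrib, Finset.mul_sum]
      refine Finset.sum_congr rfl fun i _ => ?_
      rw [Finset.mul_sum, Finset.mul_sum, ← Finset.sum_add_distrib, Finset.mul_sum]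
      refine Finset.sum_congr rfl fun j _ => ?_
      simp only [F, sub_mul (t i), Real.cos_sub]
      rw [real_inner_comm]
      ring
    have hRu : R u = p * q * (a * inner ℝ X v - b * inner ℝ Y v) := by
      simp only [R, hX, hY, sum_inner, inner_smul_left, RCLike.conj_to_real]
      rw [Finset.mul_sum, Finset.mul_sum, ← Finset.sum_sub_distrib, Finset.mul_sum]
      refine Finset.sum_congr rfl fun i _ => ?_
      simp only [F, hpq, ha, hb, sub_mul (t i), sub_mul (t i - s), add_mul s, sub_sub (t i * u),
        Real.cos_sub (t i * u)]
      ring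
    -- The modulus of `exp (isu) - exp (i(s+L)u)` does not depend on `s`; this makes the ramp bound
    -- uniform in the kink.
    have hFu : 2 * F (1 - H) L u = p * q * q * (a ^ 2 + b ^ 2) := by
      have e1 := Real.sin_sq_add_cos_sq (s * u)
      have e2 := Real.sin_sq_add_cos_sq (s * u + L * u)
      have e3 : Real.cos (L * u) = Real.cos (s * u + L * u) * Real.cos (s * u)
          + Real.sin (s * u + L * u) * Real.sin (s * u) := by
        rw [← Real.cos_sub]; ring_nf
      have e4 : a ^ 2 + b ^ 2 = 2 * (1 - Real.cos (L * u)) := by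
        rw [e3, ha, hb]; linear_combination e1 + e2
      simp only [F, hpqq, e4]
      ring
    have h1 := real_inner_self_nonneg (x := X - (r * q * a) • v)
    have h2 := real_inner_self_nonneg (x := Y + (r * q * b) • v)
    -- Completing the square in the cosine and sine parts separately.
    have key : P u - r * R u + r * r * ‖v‖ ^ 2 * F (1 - H) L u =
        p / 2 * (inner ℝ (X - (r * q * a) • v) (X - (r * q * a) • v)
          + inner ℝ (Y + (r * q * b) • v) (Y + (r * q * b) • v)) := by
      rw [hPu, hRu, show F (1 - H) L u = p * q * q * (a ^ 2 + b ^ 2) / 2 by linarith]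
      simp only [inner_sub_left, inner_sub_right, inner_add_left, inner_add_right,
        inner_smul_left, inner_smul_right, RCLike.conj_to_real, real_inner_comm X v,
        real_inner_comm Y v, ← real_inner_self_eq_norm_sq v]
      ring
    rw [key]
    positivity
  have hPR : MeasureTheory.IntegrableOn (fun u => P u - r * R u) (Set.Ioi 0) :=
    hPint.sub (hRint.const_mul r)
  rw [MeasureTheory.integral_add hPR ((hF'' L).const_mul _),
    MeasureTheory.integral_sub hPint (hRint.const_mul r), MeasureTheory.integral_const_mul,
    MeasureTheory.integral_const_mul, hP, hR, hI''] at hpos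
  linarith

/-- A uniform bound for the Cameron-Martin norms over `[0, L]` of the functions
`t ↦ max (t - s) 0`, `s ≥ 0`. -/
noncomputable def fbmRampConst (H L : ℝ) : ℝ :=
  √(fbmSpectralConst (1 - H) * |L| ^ (2 * (1 - H)) * fbmSpectralConst H)
    / fbmSpectralConst (1 / 2)

theorem fbmRampConst_nonneg (H L : ℝ) : 0 ≤ fbmRampConst H L :=
  div_nonneg (Real.sqrt_nonneg _) (fbm_aux_pos (by norm_num) (by norm_num)).le

theorem norm_sum_ramp_smul_le {H : ℝ} (h0 : 0 < H) (h1 : H < 1) {V : Type*}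
    [NormedAddCommGroup V] [InnerProductSpace ℝ V] {ι : Type*} (S : Finset ι) (t : ι → ℝ) {L : ℝ}
    (ht : ∀ i, t i ∈ Set.Icc 0 L) (w : ι → V) {s : ℝ} (hs : 0 ≤ s) :
    ‖∑ i ∈ S, max (t i - s) 0 • w i‖ ≤ fbmRampConst H L *
      √(∑ i ∈ S, ∑ j ∈ S, fbmCov H (t j) (t i) * inner ℝ (w i) (w j)) := by
  have c1 : 0 < fbmSpectralConst H := fbm_aux_pos h0 h1
  have c2 : 0 < fbmSpectralConst (1 / 2) := fbm_aux_pos (by norm_num) (by norm_num)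
  have c3 : 0 < fbmSpectralConst (1 - H) := fbm_aux_pos (by linarith) (by linarith)
  rw [fbmRampConst]
  set D := fbmSpectralConst (1 - H) * |L| ^ (2 * (1 - H)) with hD
  have hD0 : 0 ≤ D := by positivity
  set Q := ∑ i ∈ S, ∑ j ∈ S, fbmCov H (t j) (t i) * inner ℝ (w i) (w j) with hQ
  set ψ := ∑ i ∈ S, max (t i - s) 0 • w i with hψ
  -- Testing against `v = ψ` turns the scalar inequality into a bound on `‖ψ‖`, up to a common
  -- factor `‖ψ‖ ^ 2` cancelled below.
  have hd := discrim_le_zero (fbm_ramp_quadratic_nonneg h0 h1 S t ht w hs ψ)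
  rw [discrim, ← hψ, ← hQ, ← hD, real_inner_self_eq_norm_sq] at hd
  rw [div_mul_eq_mul_div, ← Real.sqrt_mul (by positivity), le_div_iff₀ c2]
  refine Real.le_sqrt_of_sq_le ?_
  rcases eq_or_ne ψ 0 with h | h
  · rw [h, norm_zero, zero_mul, zero_pow two_ne_zero]
    exact mul_nonneg (by positivity) (fbmCov_psd h0 h1 S t (fun i => (ht i).1) w)
  · have hn : 0 < ‖ψ‖ ^ 2 := by positivity
    refine le_of_mul_le_mul_right ?_ hn
    nlinarith

/-! ### Smooth pieces as superpositions of ramps. -/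

/-- Taylor's formula with integral remainder for the path frozen outside `[0, T]`: its
distributional second derivative is `f''` on `[0, T]`, plus a mass `f'(0)` at `0` and a mass
`-f'(T)` at `T`, where the motion starts and stops. -/
theorem sub_apply_zero_eq_ramp_integral {V : Type*} [NormedAddCommGroup V] [NormedSpace ℝ V]
    [CompleteSpace V] {T : ℝ} (hT : 0 < T) {f : ℝ → V} (hf : ContDiffOn ℝ 2 f (Set.Icc 0 T))
    (x : ℝ) :
    f (min (max x 0) T) - f 0 = max x 0 • derivWithin f (Set.Icc 0 T) 0
      - max (x - T) 0 • derivWithin f (Set.Icc 0 T) T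
      + ∫ s in (0 : ℝ)..T, max (x - s) 0 • iteratedDerivWithin 2 f (Set.Icc 0 T) s := by
  have hu : UniqueDiffOn ℝ (Set.Icc 0 T) := uniqueDiffOn_Icc hT
  have hc1 : ContinuousOn (derivWithin f (Set.Icc 0 T)) (Set.Icc 0 T) :=
    hf.continuousOn_derivWithin hu (by norm_num)
  have hc2 : ContinuousOn (iteratedDerivWithin 2 f (Set.Icc 0 T)) (Set.Icc 0 T) :=
    hf.continuousOn_iteratedDerivWithin (by norm_num) hu
  have hg : ∀ g : ℝ → ℝ, Continuous g → ContinuousOn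
      (fun s => g s • iteratedDerivWithin 2 f (Set.Icc 0 T) s) (Set.Icc 0 T) :=
    fun g hg => hg.continuousOn.smul hc2
  have hzero : ∀ y ∈ Set.Icc 0 T, (∀ s, y < s → s ≤ T → x ≤ s) →
      ∫ s in y..T, max (x - s) 0 • iteratedDerivWithin 2 f (Set.Icc 0 T) s = 0 := by
    intro y hy h
    refine intervalIntegral.integral_zero_ae (Filter.Eventually.of_forall fun s hs => ?_)
    rw [Set.uIoc_of_le hy.2] at hs
    rw [max_eq_right (by linarith [h s hs.1 hs.2]), zero_smul]
  rcases le_total x 0 with hx | hx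
  · rw [hzero 0 ⟨le_rfl, hT.le⟩ fun s hs _ => hx.trans hs.le, max_eq_right hx,
      max_eq_right (by linarith), min_eq_left hT.le]
    simp
  rw [max_eq_left hx]
  -- Ramps with kink beyond `x` vanish at `x`, so the integral can be cut at `y`, where the positive
  -- part disappears.
  set y := min x T with hy
  have hy0 : 0 ≤ y := le_min hx hT.le
  have hyT : y ≤ T := min_le_right _ _
  have hyx : y ≤ x := min_le_left _ _
  have hsub : Set.Icc 0 y ⊆ Set.Icc 0 T := Set.Icc_subset_Icc_right hyT
  have hint : ∀ a ∈ Set.Icc 0 T, ∀ b ∈ Set.Icc 0 T, IntervalIntegrable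
      (fun s => max (x - s) 0 • iteratedDerivWithin 2 f (Set.Icc 0 T) s)
      MeasureTheory.volume a b := fun a ha b hb =>
    ((hg _ (by fun_prop)).mono (Set.uIcc_subset_Icc ha hb)).intervalIntegrable
  have hsplit := intervalIntegral.integral_add_adjacent_intervals
    (hint 0 ⟨le_rfl, hT.le⟩ y ⟨hy0, hyT⟩) (hint y ⟨hy0, hyT⟩ T ⟨hT.le, le_rfl⟩)
  rw [hzero y ⟨hy0, hyT⟩ fun s hs hsT => ?_, add_zero] at hsplit
  swap
  · exact (min_lt_iff.1 hs).elim le_of_lt fun h => absurd hsT h.not_ge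
  have hcongr : ∫ s in (0 : ℝ)..y, max (x - s) 0 • iteratedDerivWithin 2 f (Set.Icc 0 T) s
      = ∫ s in (0 : ℝ)..y, (x - s) • iteratedDerivWithin 2 f (Set.Icc 0 T) s := by
    refine intervalIntegral.integral_congr fun s hs => ?_
    rw [Set.uIcc_of_le hy0] at hs
    simp only [max_eq_left (by linarith [hs.2] : 0 ≤ x - s)]
  have hftc : ∫ s in (0 : ℝ)..y, (x - s) • iteratedDerivWithin 2 f (Set.Icc 0 T) s
      = ((x - y) • derivWithin f (Set.Icc 0 T) y + f y)
        - ((x - 0) • derivWithin f (Set.Icc 0 T) 0 + f 0) := by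
    refine intervalIntegral.integral_eq_sub_of_hasDerivAt_of_le
      (f := fun s => (x - s) • derivWithin f (Set.Icc 0 T) s + f s) hy0 ?_ ?_ ?_
    · exact (((continuous_const.sub continuous_id).continuousOn.smul hc1).add
        hf.continuousOn).mono hsub
    · intro s hs
      have hsT : s ∈ Set.Icc 0 T := hsub ⟨hs.1.le, hs.2.le⟩
      have hnhds : Set.Icc 0 T ∈ nhds s := Icc_mem_nhds hs.1 (hs.2.trans_le hyT)
      have d1 : HasDerivAt f (derivWithin f (Set.Icc 0 T) s) s :=
        ((hf.differentiableOn (by norm_num)) s hsT).hasDerivWithinAt.hasDerivAt hnhds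
      have d2 : HasDerivAt (derivWithin f (Set.Icc 0 T))
          (iteratedDerivWithin 2 f (Set.Icc 0 T) s) s := by
        have := (hf.differentiableOn_iteratedDerivWithin (m := 1) (by norm_num) hu) s hsT
        rw [iteratedDerivWithin_one] at this
        rw [iteratedDerivWithin_succ, iteratedDerivWithin_one]
        exact this.hasDerivWithinAt.hasDerivAt hnhds
      have d3 := (((hasDerivAt_id s).const_sub x).smul d2).add d1
      exact d3.congr_deriv (by simp)
    · exact ((hg _ (by fun_prop)).mono (by rwa [Set.uIcc_of_le hy0])).intervalIntegrable
  have hend : (x - y) • derivWithin f (Set.Icc 0 T) y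
      = max (x - T) 0 • derivWithin f (Set.Icc 0 T) T := by
    rcases le_total x T with h | h
    · rw [hy, min_eq_left h, max_eq_right (by linarith), sub_self, zero_smul, zero_smul]
    · rw [hy, min_eq_right h, max_eq_left (by linarith)]
  rw [← hsplit, hcongr, hftc, hend, sub_zero]
  abel

theorem norm_le_supNormOn {V : Type*} [NormedAddCommGroup V] {T : ℝ} {f : ℝ → V}
    (hf : ContinuousOn f (Set.Icc 0 T)) {t : ℝ} (ht : t ∈ Set.Icc 0 T) :
    ‖f t‖ ≤ supNormOn T f := by
  obtain ⟨C, hC⟩ := isCompact_Icc.exists_bound_of_continuousOn hf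
  exact le_ciSup (f := fun t : Set.Icc (0 : ℝ) T => ‖f t‖)
    ⟨C, by rintro _ ⟨s, rfl⟩; exact hC s s.2⟩ ⟨t, ht⟩

theorem supNormOn_nonneg {V : Type*} [NormedAddCommGroup V] (T : ℝ) (f : ℝ → V) :
    0 ≤ supNormOn T f :=
  Real.iSup_nonneg fun _ => norm_nonneg _

theorem C2Norm_nonneg {V : Type*} [NormedAddCommGroup V] [NormedSpace ℝ V] (T : ℝ) (f : ℝ → V) :
    0 ≤ C2Norm T f :=
  add_nonneg (add_nonneg (supNormOn_nonneg _ _) (supNormOn_nonneg _ _)) (supNormOn_nonneg _ _)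

/-- The piece starts at time `a`, so its ramps have kinks at `a`, `a + T` and `a + s`. In the
constant, `2` counts the boundary ramps and `T` is the length of the integral. -/
theorem abs_sum_inner_clamp_sub_le {V : Type*} [NormedAddCommGroup V] [InnerProductSpace ℝ V]
    [CompleteSpace V] {ι : Type*} (S : Finset ι) (t : ι → ℝ) (w : ι → V) {Λ : ℝ}
    (hΛ : ∀ s, 0 ≤ s → ‖∑ i ∈ S, max (t i - s) 0 • w i‖ ≤ Λ) {a T : ℝ} (ha : 0 ≤ a) (hT : 0 < T)
    {f : ℝ → V} (hf : ContDiffOn ℝ 2 f (Set.Icc 0 T)) :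
    |∑ i ∈ S, inner ℝ (f (min (max (t i - a) 0) T) - f 0) (w i)|
      ≤ Λ * ((2 + T) * C2Norm T f) := by
  have hu : UniqueDiffOn ℝ (Set.Icc 0 T) := uniqueDiffOn_Icc hT
  have hc1 : ContinuousOn (derivWithin f (Set.Icc 0 T)) (Set.Icc 0 T) :=
    hf.continuousOn_derivWithin hu (by norm_num)
  have hc2 : ContinuousOn (iteratedDerivWithin 2 f (Set.Icc 0 T)) (Set.Icc 0 T) :=
    hf.continuousOn_iteratedDerivWithin (by norm_num) hu
  have n0 := supNormOn_nonneg T f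
  have n1 := supNormOn_nonneg T (derivWithin f (Set.Icc 0 T))
  have n2 := supNormOn_nonneg T (iteratedDerivWithin 2 f (Set.Icc 0 T))
  have hb1 : ∀ s ∈ Set.Icc 0 T, ‖derivWithin f (Set.Icc 0 T) s‖ ≤ C2Norm T f := fun s hs => by
    have := norm_le_supNormOn hc1 hs
    rw [C2Norm]; linarith
  have hb2 : ∀ s ∈ Set.Icc 0 T, ‖iteratedDerivWithin 2 f (Set.Icc 0 T) s‖ ≤ C2Norm T f :=
    fun s hs => by
      have := norm_le_supNormOn hc2 hs
      rw [C2Norm]; linarith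
  have hramp : ∀ s v, 0 ≤ s → ‖v‖ ≤ C2Norm T f →
      |inner ℝ v (∑ i ∈ S, max (t i - s) 0 • w i)| ≤ Λ * C2Norm T f := fun s v hs hv => by
    rw [mul_comm]
    exact (abs_real_inner_le_norm _ _).trans
      (mul_le_mul hv (hΛ s hs) (norm_nonneg _) (C2Norm_nonneg T f))
  have hint : ∀ i, IntervalIntegrable
      (fun s => max (t i - a - s) 0 • iteratedDerivWithin 2 f (Set.Icc 0 T) s)
      MeasureTheory.volume 0 T := fun i => by
    refine ContinuousOn.intervalIntegrable ?_
    rw [Set.uIcc_of_le hT.le]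
    exact Continuous.continuousOn (by fun_prop) |>.smul hc2
  have hinner : ∀ i, inner ℝ (∫ s in (0 : ℝ)..T,
        max (t i - a - s) 0 • iteratedDerivWithin 2 f (Set.Icc 0 T) s) (w i)
      = ∫ s in (0 : ℝ)..T,
        inner ℝ (max (t i - a - s) 0 • iteratedDerivWithin 2 f (Set.Icc 0 T) s) (w i) := fun i => by
    have := ((innerSL ℝ (w i)).intervalIntegral_comp_comm (hint i)).symm
    simpa only [innerSL_apply_apply, real_inner_comm] using this
  have hinti : ∀ i, IntervalIntegrable (fun s =>
      inner ℝ (max (t i - a - s) 0 • iteratedDerivWithin 2 f (Set.Icc 0 T) s) (w i))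
      MeasureTheory.volume 0 T := fun i => by
    refine ContinuousOn.intervalIntegrable ?_
    rw [Set.uIcc_of_le hT.le]
    exact (Continuous.continuousOn (by fun_prop) |>.smul hc2).inner continuousOn_const
  have hsum : ∑ i ∈ S, inner ℝ (f (min (max (t i - a) 0) T) - f 0) (w i)
      = inner ℝ (derivWithin f (Set.Icc 0 T) 0) (∑ i ∈ S, max (t i - a) 0 • w i)
        - inner ℝ (derivWithin f (Set.Icc 0 T) T) (∑ i ∈ S, max (t i - (a + T)) 0 • w i)
        + ∫ s in (0 : ℝ)..T, inner ℝ (iteratedDerivWithin 2 f (Set.Icc 0 T) s)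
          (∑ i ∈ S, max (t i - (a + s)) 0 • w i) := by
    simp only [inner_sum]
    rw [intervalIntegral.integral_finsetSum fun i _ => by
        simpa only [inner_smul_left, inner_smul_right, RCLike.conj_to_real, sub_sub] using hinti i,
      ← Finset.sum_sub_distrib, ← Finset.sum_add_distrib]
    refine Finset.sum_congr rfl fun i _ => ?_
    rw [sub_apply_zero_eq_ramp_integral hT hf, inner_add_left, inner_sub_left, hinner]
    simp only [inner_smul_left, inner_smul_right, RCLike.conj_to_real, sub_sub]
  rw [hsum]
  have r1 := hramp a _ ha (hb1 0 ⟨le_rfl, hT.le⟩)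
  have r2 := hramp (a + T) _ (by linarith) (hb1 T ⟨hT.le, le_rfl⟩)
  have r3 : |∫ s in (0 : ℝ)..T, inner ℝ (iteratedDerivWithin 2 f (Set.Icc 0 T) s)
      (∑ i ∈ S, max (t i - (a + s)) 0 • w i)| ≤ Λ * C2Norm T f * |T - 0| := by
    refine intervalIntegral.norm_integral_le_of_norm_le_const (E := ℝ) fun s hs => ?_
    rw [Set.uIoc_of_le hT.le] at hs
    exact hramp (a + s) _ (by linarith [hs.1]) (hb2 s ⟨hs.1.le, hs.2⟩)
  rw [sub_zero, abs_of_pos hT] at r3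
  calc _ ≤ _ := abs_add_le _ _
    _ ≤ Λ * C2Norm T f + Λ * C2Norm T f + Λ * C2Norm T f * T :=
      add_le_add ((abs_sub _ _).trans (add_le_add r1 r2)) r3
    _ = _ := by ring

/-! ### Concatenations and conclusion. -/

/-- Freezing a concatenation at its end time makes it a plain sum of frozen pieces, valid for every
`t`, which linear functionals can split. -/
theorem concatTwo_min {V : Type*} [AddCommGroup V] {S T : ℝ} (hT : 0 ≤ T) (f g : ℝ → V) (t : ℝ) :
    concatTwo S f g (min t (S + T)) = f (min t S) + (g (min (max (t - S) 0) T) - g 0) := by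
  rcases le_total t S with h | h
  · rw [concatTwo, min_eq_left (by linarith), if_pos h, min_eq_left h, max_eq_right (by linarith),
      min_eq_left hT, sub_self, add_zero]
  · rw [min_eq_right h, max_eq_left (by linarith),
      show min t (S + T) = S + min (t - S) T by rw [← min_add_add_left]; congr 1; ring, concatTwo]
    split_ifs with h'
    · have h0 : min (t - S) T = 0 := le_antisymm (by linarith) (le_min (by linarith) hT)
      rw [h0, add_zero, sub_self, add_zero]
    · rw [add_sub_cancel_left]

/-- The cut-off by `min` lets the induction hypothesis apply to the same times `t i`, including
those past the end of the first pieces. -/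
theorem abs_sum_inner_concatPaths_le {V : Type*} [NormedAddCommGroup V] [InnerProductSpace ℝ V]
    [CompleteSpace V] {ι : Type*} (S : Finset ι) (t : ι → ℝ) (ht : ∀ i, 0 ≤ t i) (w : ι → V)
    {Λ : ℝ} (hΛ : ∀ s, 0 ≤ s → ‖∑ i ∈ S, max (t i - s) 0 • w i‖ ≤ Λ) (n : ℕ)
    (T : Fin (n + 1) → ℝ) (hT : ∀ k, 0 < T k) (h : Fin (n + 1) → ℝ → V)
    (hh : ∀ k, ContDiffOn ℝ 2 (h k) (Set.Icc 0 (T k))) (h00 : h 0 0 = 0) :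
    |∑ i ∈ S, inner ℝ (concatPaths n T h (min (t i) (∑ k, T k))) (w i)|
      ≤ Λ * ∑ k, (2 + T k) * C2Norm (T k) (h k) := by
  induction n with
  | zero =>
    have := abs_sum_inner_clamp_sub_le S t w hΛ le_rfl (hT 0) (hh 0)
    simpa [concatPaths, h00, max_eq_left (ht _)] using this
  | succ n ih =>
    have h1 := ih (fun k => T k.castSucc) (fun k => hT _) (fun k => h k.castSucc)
      (fun k => hh _) h00
    have h2 := abs_sum_inner_clamp_sub_le S t w hΛ
      (Finset.sum_nonneg (s := Finset.univ) fun (k : Fin (n + 1)) _ => (hT k.castSucc).le)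
      (hT (Fin.last _)) (hh (Fin.last _))
    rw [Fin.sum_univ_castSucc (f := T),
      Fin.sum_univ_castSucc (f := fun k => (2 + T k) * C2Norm (T k) (h k)), mul_add]
    simp only [concatPaths, concatTwo_min (hT (Fin.last _)).le, inner_add_left,
      Finset.sum_add_distrib]
    exact (abs_add_le _ _).trans (add_le_add h1 h2)

theorem norm_sum_kerFun_sq (H : Set.Ioo (0 : ℝ) 1) (T : ℝ) (d : ℕ)
    (w : Set.Icc (0 : ℝ) T →₀ EuclideanSpace ℝ (Fin d)) :
    ‖w.sum fun x v => RKHS.kerFun (FBmCameronMartin H T d) x v‖ ^ 2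
      = ∑ i ∈ w.support, ∑ j ∈ w.support, fbmCov H j i * inner ℝ (w i) (w j) := by
  rw [← real_inner_self_eq_norm_sq, Finsupp.sum, sum_inner]
  refine Finset.sum_congr rfl fun i _ => ?_
  rw [inner_sum]
  refine Finset.sum_congr rfl fun j _ => ?_
  rw [← RKHS.kernel_inner, RKHS.OfKernel.kernel_ofKernel]
  simp [fbmKernel, inner_smul_left]

theorem exists_cameronMartin_eq_concatPaths (H : Set.Ioo (0 : ℝ) 1) (n : ℕ)
    (T : Fin (n + 1) → ℝ) (hT : ∀ k, 0 < T k) (d : ℕ)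
    (h : Fin (n + 1) → ℝ → EuclideanSpace ℝ (Fin d))
    (hh : ∀ k, ContDiffOn ℝ 2 (h k) (Set.Icc 0 (T k))) (h00 : h 0 0 = 0) :
    ∃ g : FBmCameronMartin H (∑ k, T k) d, (∀ t, g t = concatPaths n T h t) ∧
      ‖g‖ ≤ fbmRampConst H (∑ k, T k) * ∑ k, (2 + T k) * C2Norm (T k) (h k) := by
  refine RKHS.exists_norm_le_of_abs_sum_inner_le (mul_nonneg (fbmRampConst_nonneg _ _)
    (Finset.sum_nonneg fun k _ => mul_nonneg (by linarith [hT k]) (C2Norm_nonneg _ _)))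
    fun w => ?_
  have hramp := fun s (hs : 0 ≤ s) => norm_sum_ramp_smul_le H.2.1 H.2.2 w.support
    (fun i : Set.Icc (0 : ℝ) (∑ k, T k) => (i : ℝ)) (fun i => i.2) w hs
  rw [← norm_sum_kerFun_sq, Real.sqrt_sq (norm_nonneg _)] at hramp
  have key := abs_sum_inner_concatPaths_le w.support _ (fun i => i.2.1) w hramp n T hT h hh h00
  rw [mul_right_comm]
  simpa only [Finsupp.sum, min_eq_left (Subtype.prop _ : _ ∈ Set.Icc (0 : ℝ) _).2] using key

theorem mainTheorem8 (H : Set.Ioo (0 : ℝ) 1) (n : ℕ) (T : Fin (n + 1) → ℝ)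
    (hT : ∀ k, 0 < T k) :
    (∀ (d : ℕ) (h : Fin (n + 1) → ℝ → EuclideanSpace ℝ (Fin d)),
      (∀ k, ContDiffOn ℝ ∞ (h k) (Set.Icc 0 (T k))) → h 0 0 = 0 →
        ∃ g : FBmCameronMartin H (∑ k, T k) d, ∀ t, g t = concatPaths n T h t) ∧
    (∀ M : Fin (n + 1) → ℝ, ∃ C : ℝ,
      ∀ (d : ℕ) (h : Fin (n + 1) → ℝ → EuclideanSpace ℝ (Fin d)),
        (∀ k, ContDiffOn ℝ ∞ (h k) (Set.Icc 0 (T k))) → h 0 0 = 0 →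
        (∀ k, C2Norm (T k) (h k) ≤ M k) →
          ∀ g : FBmCameronMartin H (∑ k, T k) d,
            (∀ t, g t = concatPaths n T h t) → ‖g‖ ≤ C) := by
  refine ⟨fun d h hh h00 => ?_, fun M =>
    ⟨fbmRampConst H (∑ k, T k) * ∑ k, (2 + T k) * M k, fun d h hh h00 hM g hg => ?_⟩⟩
  · obtain ⟨g, hg, -⟩ := exists_cameronMartin_eq_concatPaths H n T hT d h
      (fun k => (hh k).of_le (WithTop.coe_le_coe.2 le_top)) h00
    exact ⟨g, hg⟩
  · obtain ⟨g', hg', hle⟩ := exists_cameronMartin_eq_concatPaths H n T hT d h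
      (fun k => (hh k).of_le (WithTop.coe_le_coe.2 le_top)) h00
    -- An element of the RKHS is determined by its values, so the norm bound for the constructed
    -- element holds for any `g` representing the path.
    have hgg : g = g' := RKHS.ext fun t => (hg t).trans (hg' t).symm
    rw [hgg]
    refine hle.trans (mul_le_mul_of_nonneg_left (Finset.sum_le_sum fun k _ => ?_)
      (fbmRampConst_nonneg _ _))
    exact mul_le_mul_of_nonneg_left (hM k) (by linarith [hT k])
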